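/- Let $A$ be a separable $C^*$-algebra and let $K$ be an essential ideal of $A$ (a norm-closed two-sided ideal such that $a\in A$, $aK=0$ imply $a=0$). A $C^*$-algebra $B$ is regarded as a Hilbert module over itself, with right multiplication as the module action and $\langle a,b\rangle=a^*b$. For a densely defined linear operator $T:D(T)\subseteq B\to B$, the adjoint $T^*$ has as domain the set of all $y\in B$ for which there is a $z\in B$ with $\langle Tx,y\rangle=\langle x,z\rangle$ for all $x\in D(T)$, and $T^*y=z$. The operator $T$ is called semiregular if $D(T)$ is a dense right ideal of $B$, $T$ is closable and $T^*$ is densely defined; it is called regular if it is closed and semiregular and the range of $I+T^*T$ is dense in $B$, where $D(T^*T)=\{x\in D(T):Tx\in D(T^*)\}$. Let $S$ be a closed semiregular operator on $A$. Then $S$ maps $D(S)\cap K$ into $K$; let $S|_K$, with domain $D(S)\cap K$, be the restriction of $S$, an operator on the $C^*$-algebra $K$. Let $\pi:A\to A/K$ be the quotient map and let $Z(A/K)$ be the centre of $A/K$. Suppose that $S|_K$ is a regular operator on $K$ and that the set $$\bigl(Z(A/K)\cap\pi(D(S))\bigr)\,(A/K)=\{cb : c\in Z(A/K)\cap\pi(D(S)),\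 b\in A/K\}$$ is total in $A/K$ (its linear span is dense). Then $S^{**}$ is a regular operator on $A$. -/

import Mathlib

/-! ## Closed ideals of a C*-algebra, and quotients by them -/

/-- An ideal of a C*-algebra: a norm-closed two-sided ideal (a complex subspace that absorbs
multiplication on both sides). -/
structure ClosedIdeal (A : Type*) [NonUnitalCStarAlgebra A] extends Submodule ℂ A where
  isClosed_carrier : IsClosed carrier
  mul_mem_left : ∀ (a : A) {k : A}, k ∈ carrier → a * k ∈ carrier
  mul_mem_right : ∀ {k : A} (a : A), k ∈ carrier → k * a ∈ carrier

namespace ClosedIdeal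

variable {A : Type*} [NonUnitalCStarAlgebra A] (K : ClosedIdeal A)

/-- The self-adjoint part `K ∩ K*` of a closed ideal, used only to prove that `K = K*`. -/
def symmPart : NonUnitalStarSubalgebra ℂ A where
  carrier := {a | a ∈ K.toSubmodule ∧ star a ∈ K.toSubmodule}
  zero_mem' := ⟨K.toSubmodule.zero_mem, by rw [star_zero]; exact K.toSubmodule.zero_mem⟩
  add_mem' := fun ha hb => ⟨K.toSubmodule.add_mem ha.1 hb.1,
    by rw [star_add]; exact K.toSubmodule.add_mem ha.2 hb.2⟩
  mul_mem' := fun ha hb => ⟨K.mul_mem_left _ hb.1,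
    by rw [star_mul]; exact K.mul_mem_left _ ha.2⟩
  smul_mem' := fun c _ ha => ⟨K.toSubmodule.smul_mem c ha.1,
    by rw [star_smul]; exact K.toSubmodule.smul_mem _ ha.2⟩
  star_mem' := fun ha => ⟨ha.2, by rw [star_star]; exact ha.1⟩

theorem isClosed_symmPart : IsClosed (K.symmPart : Set A) :=
  IsClosed.inter K.isClosed_carrier (K.isClosed_carrier.preimage continuous_star)

/-- A closed two-sided ideal of a C*-algebra is self-adjoint. -/
theorem star_mem {a : A} (ha : a ∈ K.toSubmodule) : star a ∈ K.toSubmodule := by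
  have : IsClosed (K.symmPart : Set A) := K.isClosed_symmPart
  let : PartialOrder K.symmPart := CStarAlgebra.spectralOrder K.symmPart
  have : StarOrderedRing K.symmPart := CStarAlgebra.spectralOrderedRing K.symmPart
  let b : K.symmPart := ⟨a * star a, K.mul_mem_right _ ha, by
    rw [star_mul, star_star]; exact K.mul_mem_right _ ha⟩
  have hunit := CStarAlgebra.increasingApproximateUnit K.symmPart
  have hb : Filter.Tendsto (fun e : K.symmPart => b * e) (CStarAlgebra.approximateUnit K.symmPart)
      (nhds b) := hunit.tendsto_mul_left b
  have hb' : Filter.Tendsto (fun e : K.symmPart => ‖b - b * e‖)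
      (CStarAlgebra.approximateUnit K.symmPart) (nhds 0) := by
    have := (tendsto_const_nhds (x := b)).sub hb
    simpa using this.norm
  have hev : ∀ᶠ e : K.symmPart in CStarAlgebra.approximateUnit K.symmPart,
      ‖star a - star a * (e : A)‖ ^ 2 ≤ 2 * ‖b - b * e‖ := by
    filter_upwards [hunit.eventually_star_eq, hunit.eventually_norm] with e he hn
    have he' : star (e : A) = e := congrArg Subtype.val he
    have hn' : ‖(e : A)‖ ≤ 1 := hn
    have key : star (star a - star a * (e : A)) * (star a - star a * (e : A)) =
        ((b - b * e : K.symmPart) : A) - (e : A) * ((b - b * e : K.symmPart) : A) := by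
      simp only [star_sub, star_star, star_mul, he', NonUnitalStarSubalgebra.coe_sub,
        NonUnitalStarSubalgebra.coe_mul, b]
      noncomm_ring
    have h1 : ‖star a - star a * (e : A)‖ ^ 2 =
        ‖((b - b * e : K.symmPart) : A) - (e : A) * ((b - b * e : K.symmPart) : A)‖ := by
      rw [← key, CStarRing.norm_star_mul_self, pow_two]
    have h2 : ‖(e : A) * ((b - b * e : K.symmPart) : A)‖ ≤ ‖b - b * e‖ := by
      refine (norm_mul_le _ _).trans ?_
      calc ‖(e : A)‖ * ‖((b - b * e : K.symmPart) : A)‖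
          ≤ 1 * ‖((b - b * e : K.symmPart) : A)‖ := by gcongr
        _ = ‖b - b * e‖ := by rw [one_mul]; rfl
    rw [h1]
    refine (norm_sub_le _ _).trans ?_
    have h3 : ‖((b - b * e : K.symmPart) : A)‖ = ‖b - b * e‖ := rfl
    linarith
  have hsq : Filter.Tendsto (fun e : K.symmPart => ‖star a - star a * (e : A)‖ ^ 2)
      (CStarAlgebra.approximateUnit K.symmPart) (nhds 0) := by
    refine tendsto_of_tendsto_of_tendsto_of_le_of_le' tendsto_const_nhds
      (by simpa using hb'.const_mul 2) (Filter.Eventually.of_forall fun e => by positivity) hev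
  have hnorm : Filter.Tendsto (fun e : K.symmPart => ‖star a * (e : A) - star a‖)
      (CStarAlgebra.approximateUnit K.symmPart) (nhds 0) := by
    have := (Real.continuous_sqrt.tendsto 0).comp hsq
    simp only [Real.sqrt_zero] at this
    refine this.congr fun e => ?_
    simp only [Function.comp_apply]
    rw [Real.sqrt_sq (norm_nonneg _), norm_sub_rev]
  exact K.isClosed_carrier.mem_of_tendsto (tendsto_iff_norm_sub_tendsto_zero.2 hnorm)
    (Filter.Eventually.of_forall fun e => K.mul_mem_left _ e.2.1)

/-- The closed ideal `K`, as a star-subalgebra of `A`. -/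
def toStarSubalgebra : NonUnitalStarSubalgebra ℂ A where
  carrier := K.carrier
  zero_mem' := K.toSubmodule.zero_mem
  add_mem' := fun ha hb => K.toSubmodule.add_mem ha hb
  mul_mem' := fun _ hb => K.mul_mem_left _ hb
  smul_mem' := fun c _ ha => K.toSubmodule.smul_mem c ha
  star_mem' := fun ha => K.star_mem ha

instance : IsClosed (K.toStarSubalgebra : Set A) := K.isClosed_carrier

instance : IsClosed (K.toSubmodule : Set A) := K.isClosed_carrier

/-- The ideal `K`, regarded as a C*-algebra in its own right (with the operations, involution and
norm of `A`). -/
abbrev Alg : Type _ := K.toStarSubalgebra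

/-- `K` is an essential ideal of `A`: no nonzero element of `A` annihilates `K`. -/
def IsEssential : Prop := ∀ a : A, (∀ k ∈ K.toSubmodule, a * k = 0) → a = 0

/-- The quotient `A / K`, a complex vector space with the quotient norm. -/
abbrev Quotient : Type _ := A ⧸ K.toSubmodule

/-- The canonical projection `π : A → A / K`. -/
def proj : A →ₗ[ℂ] K.Quotient := K.toSubmodule.mkQ

/-- The product of `A / K`, determined by `π a * π b = π (a * b)`. -/
noncomputable instance : Mul K.Quotient where
  mul x y := Quotient.liftOn₂' x y (fun a b => K.proj (a * b)) (by
    intro a b a' b' h h'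
    rw [Submodule.quotientRel_def] at h h'
    refine (Submodule.Quotient.eq K.toSubmodule).2 ?_
    have : a * b - a' * b' = (a - a') * b + a' * (b - b') := by noncomm_ring
    rw [this]
    exact K.toSubmodule.add_mem (K.mul_mem_right _ h) (K.mul_mem_left _ h'))

theorem proj_mul (a b : A) : K.proj (a * b) = K.proj a * K.proj b := rfl

theorem proj_surjective : Function.Surjective K.proj := K.toSubmodule.mkQ_surjective

noncomputable instance : NonUnitalRing K.Quotient where
  left_distrib x y z := by
    obtain ⟨a, rfl⟩ := K.proj_surjective x
    obtain ⟨b, rfl⟩ := K.proj_surjective y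
    obtain ⟨c, rfl⟩ := K.proj_surjective z
    simp only [← map_add, ← proj_mul, mul_add]
  right_distrib x y z := by
    obtain ⟨a, rfl⟩ := K.proj_surjective x
    obtain ⟨b, rfl⟩ := K.proj_surjective y
    obtain ⟨c, rfl⟩ := K.proj_surjective z
    simp only [← map_add, ← proj_mul, add_mul]
  zero_mul x := by
    obtain ⟨a, rfl⟩ := K.proj_surjective x
    rw [← map_zero K.proj, ← proj_mul, zero_mul]
  mul_zero x := by
    obtain ⟨a, rfl⟩ := K.proj_surjective x
    rw [← map_zero K.proj, ← proj_mul, mul_zero]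
  mul_assoc x y z := by
    obtain ⟨a, rfl⟩ := K.proj_surjective x
    obtain ⟨b, rfl⟩ := K.proj_surjective y
    obtain ⟨c, rfl⟩ := K.proj_surjective z
    simp only [← proj_mul, mul_assoc]

end ClosedIdeal

/-! ## Unbounded operators on a C*-algebra

A C*-algebra `B` is a Hilbert module over itself, with the right multiplication as module action
and the `B`-valued inner product `⟨a, b⟩ = a* b`. An operator on `B` is a complex-linear map
`T : B →ₗ.[ℂ] B` defined on a subspace `T.domain` of `B`. -/

namespace CStarOp

variable {B : Type*} [NonUnitalCStarAlgebra B]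

/-- The graph of the adjoint: the pairs `(y, z)` with `⟨T x, y⟩ = ⟨x, z⟩` for all `x` in the domain
of `T`. -/
def adjointGraph (T : B →ₗ.[ℂ] B) : Submodule ℂ (B × B) where
  carrier := {p | ∀ x : T.domain, star (T x) * p.1 = star (x : B) * p.2}
  zero_mem' := fun x => by simp
  add_mem' := fun {p q} hp hq x => by simp [mul_add, hp x, hq x]
  smul_mem' := fun c p hp x => by
    simp only [Prod.smul_fst, Prod.smul_snd, mul_smul_comm, hp x]

/-- The adjoint `T*` of a densely defined operator `T`: its domain consists of the `y` for which
there is a `z` with `⟨T x, y⟩ = ⟨x, z⟩` for all `x` in the domain of `T`, and `T* y = z`. -/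
noncomputable def adjoint (T : B →ₗ.[ℂ] B) : B →ₗ.[ℂ] B := (adjointGraph T).toLinearPMap

/-- If `T` is densely defined, then the element `z` in the definition of `T*` is unique, so that
`T*` is the operator with the graph above. -/
theorem adjoint_graph {T : B →ₗ.[ℂ] B} (hT : Dense (T.domain : Set B)) :
    (adjoint T).graph = adjointGraph T := by
  refine Submodule.toLinearPMap_graph_eq _ ?_
  rintro ⟨y, z⟩ hp (rfl : y = 0)
  have h0 : ∀ x ∈ (T.domain : Set B), star x * z = 0 := fun x hx => by
    simpa using (hp ⟨x, hx⟩).symm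
  have hcl : IsClosed {x : B | star x * z = 0} :=
    isClosed_eq (continuous_star.mul continuous_const) continuous_const
  have hz : star z * z = 0 := by
    have : closure (T.domain : Set B) ⊆ {x : B | star x * z = 0} := closure_minimal h0 hcl
    exact this (hT z)
  exact CStarRing.star_mul_self_eq_zero_iff z |>.1 hz

/-- `T` is semiregular: its domain is a dense right submodule, `T` is closable, and `T*` is densely
defined. (That `T (a * b) = T a * b` then follows.) -/
structure IsSemiregular (T : B →ₗ.[ℂ] B) : Prop where
  domain_mul_mem : ∀ a ∈ T.domain, ∀ b : B, a * b ∈ T.domain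
  dense_domain : Dense (T.domain : Set B)
  isClosable : T.IsClosable
  dense_adjoint_domain : Dense ((adjoint T).domain : Set B)

/-- The range of `I + T* T`, where `T* T` has the domain `{x ∈ D(T) | T x ∈ D(T*)}`. -/
def rangeOneAddAdjointMul (T : B →ₗ.[ℂ] B) : Set B :=
  {w | ∃ (x : T.domain) (hx : T x ∈ (adjoint T).domain), w = (x : B) + adjoint T ⟨T x, hx⟩}

/-- `T` is regular: a closed semiregular operator for which `I + T* T` has dense range. -/
structure IsRegular (T : B →ₗ.[ℂ] B) : Prop where
  isSemiregular : IsSemiregular T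
  isClosed : T.IsClosed
  dense_range : Dense (rangeOneAddAdjointMul T)

end CStarOp

/-! ## Restriction of an operator to a closed ideal -/

namespace CStarOp

variable {A : Type*} [NonUnitalCStarAlgebra A]

/-- The restriction `S|_K` of `S` to the ideal `K`, as an operator on the C*-algebra `K`: its graph
is `{(a, S a) | a ∈ D(S) ∩ K, S a ∈ K}`. For semiregular `S` the condition `S a ∈ K` holds
automatically (see `mem_restrict_domain_iff`), so that the domain is `D(S) ∩ K`. -/
noncomputable def restrict (S : A →ₗ.[ℂ] A) (K : ClosedIdeal A) : K.Alg →ₗ.[ℂ] K.Alg :=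
  (S.graph.comap (LinearMap.prodMap (NonUnitalSubalgebra.toSubmodule
    K.toStarSubalgebra.toNonUnitalSubalgebra).subtype (NonUnitalSubalgebra.toSubmodule
    K.toStarSubalgebra.toNonUnitalSubalgebra).subtype)).toLinearPMap

theorem mem_restrict_graph_iff (S : A →ₗ.[ℂ] A) (K : ClosedIdeal A) (p : K.Alg × K.Alg) :
    p ∈ (restrict S K).graph ↔ ((p.1 : A), (p.2 : A)) ∈ S.graph := by
  unfold restrict
  rw [Submodule.toLinearPMap_graph_eq]
  · rfl
  · rintro ⟨a, b⟩ h ha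
    have h' : ((a : A), (b : A)) ∈ S.graph := h
    have ha' : (a : A) = 0 := by simpa using congrArg Subtype.val ha
    have hb : (b : A) = 0 := LinearPMap.graph_fst_eq_zero_snd S h' ha'
    exact Subtype.ext hb

/-- A semiregular operator maps `D(S) ∩ K` into `K`. -/
theorem IsSemiregular.apply_mem {S : A →ₗ.[ℂ] A} (hS : IsSemiregular S) (K : ClosedIdeal A)
    (a : S.domain) (ha : (a : A) ∈ K.toSubmodule) : S a ∈ K.toSubmodule := by
  let : PartialOrder A := CStarAlgebra.spectralOrder A
  have : StarOrderedRing A := CStarAlgebra.spectralOrderedRing A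
  have h1 : ∀ y ∈ ((adjoint S).domain : Set A), star y * S a ∈ K.toSubmodule := by
    intro y hy
    have hg : (y, adjoint S ⟨y, hy⟩) ∈ adjointGraph S := by
      rw [← adjoint_graph hS.dense_domain]
      exact LinearPMap.mem_graph (adjoint S) ⟨y, hy⟩
    have := congrArg star (hg a)
    simp only [star_mul, star_star] at this
    rw [this]
    exact K.mul_mem_left _ ha
  have hcl : IsClosed {y : A | star y * S a ∈ K.toSubmodule} :=
    K.isClosed_carrier.preimage (continuous_star.mul continuous_const)
  have h2 : ∀ y : A, star y * S a ∈ K.toSubmodule := fun y =>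
    closure_minimal h1 hcl (hS.dense_adjoint_domain y)
  have h3 := (CStarAlgebra.increasingApproximateUnit A).tendsto_mul_right (S a)
  refine K.isClosed_carrier.mem_of_tendsto h3 (Filter.Eventually.of_forall fun e => ?_)
  have := h2 (star e)
  rwa [star_star] at this

/-- For semiregular `S`, the domain of `S|_K` is `D(S) ∩ K`. -/
theorem mem_restrict_domain_iff {S : A →ₗ.[ℂ] A} (hS : IsSemiregular S) (K : ClosedIdeal A)
    (a : K.Alg) : a ∈ (restrict S K).domain ↔ (a : A) ∈ S.domain := by
  constructor
  · intro ha
    have h := (mem_restrict_graph_iff S K _).1 (LinearPMap.mem_graph (restrict S K) ⟨a, ha⟩)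
    exact LinearPMap.mem_domain_of_mem_graph h
  · intro ha
    have hm := hS.apply_mem K ⟨a, ha⟩ a.2
    have h : ((a : A), S ⟨a, ha⟩) ∈ S.graph := LinearPMap.mem_graph S ⟨a, ha⟩
    exact LinearPMap.mem_domain_of_mem_graph
      ((mem_restrict_graph_iff S K (a, ⟨S ⟨a, ha⟩, hm⟩)).2 h)

end CStarOp

/-!
The proof works with graphs. For a subspace `G` of `B × B` let `G⊥` be its orthogonal complement
for the `B`-valued inner product. Up to the rotation `(y, t) ↦ (t, -y)`, the graph of `S*` is the
complement `(graph S)⊥`, and the graph of `S**` is `(graph S)⊥⊥`. The sum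
`F = (graph S)⊥⊥ + (graph S)⊥` is closed, because its summands are closed and orthogonal
(`isClosed_sup_of_orthogonal`), and `(a, 0) ∈ F` says exactly that `a` is in the range of
`I + S* S**`. Hence `E = {a | (a, 0) ∈ F}` is a closed right ideal, and one has to show that
`E = A`.

* Regularity of `T = S|_K` gives `K × K = graph T + (graph T)⊥` (`IsRegular.graph_sup_orth`), and
  both summands lie in `F`; hence `K × K ⊆ F`, and one may compute modulo `K`.
* Let `c ∈ D(S)` be central modulo `K`, and `s = S c`. For `y ∈ D(S*)` the pair
  `(S* y, -y) b c*` is in `F`, and modulo `K` its first entry is `c* (S* y) b = s* y b`. As `D(S*)`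
  is dense, `(s* a, -a c*) ∈ F` for all `a`. With `a = s`, adding `(c, s) c* ∈ graph S`, one finds
  `c* c + s* s ∈ E`.
* A closed right ideal that contains `c* c + s* s` contains `c*`
  (`star_mem_of_star_mul_add_star_mul_mem`), hence `c* c`, hence `c c*` (modulo `K`), hence `c`.

So `E` contains `K` and every `c b`, and by totality it is all of `A`.
-/

namespace CStarOp

variable {B : Type*} [NonUnitalCStarAlgebra B]

/-! ### Orthogonal complements in the Hilbert module `B × B` -/

/-- The orthogonal complement of a subspace of `B × B` for the `B`-valued inner product
`⟨p, q⟩ = p₁* q₁ + p₂* q₂`. -/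
def orth (G : Submodule ℂ (B × B)) : Submodule ℂ (B × B) where
  carrier := {q | ∀ p ∈ G, star p.1 * q.1 + star p.2 * q.2 = 0}
  zero_mem' := fun p _ => by simp
  add_mem' := fun {q r} hq hr p hp => by
    have : star p.1 * (q + r).1 + star p.2 * (q + r).2 =
        (star p.1 * q.1 + star p.2 * q.2) + (star p.1 * r.1 + star p.2 * r.2) := by
      simp only [Prod.fst_add, Prod.snd_add, mul_add]
      abel
    rw [this, hq p hp, hr p hp, add_zero]
  smul_mem' := fun c q hq p hp => by
    simp only [Prod.smul_fst, Prod.smul_snd, mul_smul_comm]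
    rw [← smul_add, hq p hp, smul_zero]

theorem mem_orth {G : Submodule ℂ (B × B)} {q : B × B} :
    q ∈ orth G ↔ ∀ p ∈ G, star p.1 * q.1 + star p.2 * q.2 = 0 := Iff.rfl

theorem isClosed_orth (G : Submodule ℂ (B × B)) : IsClosed (orth G : Set (B × B)) := by
  have : (orth G : Set (B × B)) = ⋂ p ∈ G, {q | star p.1 * q.1 + star p.2 * q.2 = 0} := by
    ext q
    simp [mem_orth]
  rw [this]
  exact isClosed_biInter fun p _ => isClosed_eq (by fun_prop) continuous_const

theorem orth_mul_mem {G : Submodule ℂ (B × B)} {q : B × B} (hq : q ∈ orth G) (b : B) :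
    (q.1 * b, q.2 * b) ∈ orth G := fun p hp => by
  simp only [← mul_assoc, ← add_mul, hq p hp, zero_mul]

theorem le_orth_orth (G : Submodule ℂ (B × B)) : G ≤ orth (orth G) := fun p hp q hq => by
  simpa using congrArg star (hq p hp)

/-- Orthogonal pairs satisfy `‖p‖ ≤ √2 ‖p + q‖ ≤ 2 ‖p + q‖`, since `⟨p, p⟩ ≤ ⟨p + q, p + q⟩`. -/
theorem norm_le_of_orthogonal {p q : B × B} (h : star p.1 * q.1 + star p.2 * q.2 = 0) :
    ‖p‖ ≤ 2 * ‖p + q‖ := by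
  let : PartialOrder B := CStarAlgebra.spectralOrder B
  have : StarOrderedRing B := CStarAlgebra.spectralOrderedRing B
  have h' : star q.1 * p.1 + star q.2 * p.2 = 0 := by simpa using congrArg star h
  have key : star (p + q).1 * (p + q).1 + star (p + q).2 * (p + q).2 =
      (star p.1 * p.1 + star p.2 * p.2) + (star q.1 * q.1 + star q.2 * q.2) := by
    calc star (p + q).1 * (p + q).1 + star (p + q).2 * (p + q).2
        = (star p.1 * p.1 + star p.2 * p.2) + (star q.1 * q.1 + star q.2 * q.2)
          + (star p.1 * q.1 + star p.2 * q.2) + (star q.1 * p.1 + star q.2 * p.2) := by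
          simp only [Prod.fst_add, Prod.snd_add, star_add]
          noncomm_ring
      _ = _ := by rw [h, h', add_zero, add_zero]
  have hbound : ‖star (p + q).1 * (p + q).1 + star (p + q).2 * (p + q).2‖ ≤ 2 * ‖p + q‖ ^ 2 := by
    refine (norm_add_le _ _).trans ?_
    rw [CStarRing.norm_star_mul_self, CStarRing.norm_star_mul_self]
    have h1 := norm_fst_le (p + q)
    have h2 := norm_snd_le (p + q)
    nlinarith [norm_nonneg (p + q).1, norm_nonneg (p + q).2]
  have hcomp : ∀ x : B, star x * x ≤ star (p + q).1 * (p + q).1 + star (p + q).2 * (p + q).2 →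
      ‖x‖ ≤ 2 * ‖p + q‖ := fun x hx => by
    have hn := CStarAlgebra.norm_le_norm_of_nonneg_of_le (star_mul_self_nonneg x) hx
    rw [CStarRing.norm_star_mul_self] at hn
    refine abs_le_of_sq_le_sq' ?_ (by positivity) |>.2
    nlinarith [norm_nonneg (p + q)]
  have hq : 0 ≤ star q.1 * q.1 + star q.2 * q.2 :=
    add_nonneg (star_mul_self_nonneg _) (star_mul_self_nonneg _)
  refine max_le (hcomp _ ?_) (hcomp _ ?_) <;> rw [key]
  · exact (le_add_of_nonneg_right (star_mul_self_nonneg _)).trans (le_add_of_nonneg_right hq)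
  · exact (le_add_of_nonneg_left (star_mul_self_nonneg _)).trans (le_add_of_nonneg_right hq)

/-- The sum of two closed orthogonal subspaces of `B × B` is closed. -/
theorem isClosed_sup_of_orthogonal {G H : Submodule ℂ (B × B)} (hG : IsClosed (G : Set (B × B)))
    (hH : IsClosed (H : Set (B × B))) (hGH : H ≤ orth G) :
    IsClosed ((G ⊔ H : Submodule ℂ (B × B)) : Set (B × B)) := by
  have : CompleteSpace G := hG.completeSpace_coe
  have : CompleteSpace H := hH.completeSpace_coe
  let f : G × H →L[ℂ] B × B := G.subtypeL.coprod H.subtypeL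
  have hf : AntilipschitzWith 2 f := by
    refine AddMonoidHomClass.antilipschitz_of_bound f fun x => ?_
    have h1 : star x.1.1.1 * x.2.1.1 + star x.1.1.2 * x.2.1.2 = 0 := hGH x.2.2 _ x.1.2
    have h2 : star x.2.1.1 * x.1.1.1 + star x.2.1.2 * x.1.1.2 = 0 := by
      simpa using congrArg star h1
    refine max_le (norm_le_of_orthogonal h1) ?_
    have := norm_le_of_orthogonal h2
    rwa [add_comm] at this
  have hrange : Set.range f = ((G ⊔ H : Submodule ℂ (B × B)) : Set (B × B)) := by
    ext p
    simp only [SetLike.mem_coe, Submodule.mem_sup]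
    constructor
    · rintro ⟨x, rfl⟩
      exact ⟨x.1, x.1.2, x.2, x.2.2, rfl⟩
    · rintro ⟨g, hg, h, hh, rfl⟩
      exact ⟨(⟨g, hg⟩, ⟨h, hh⟩), rfl⟩
  rw [← hrange]
  exact hf.isClosed_range f.uniformContinuous

/-! ### Adjoints and graphs -/

theorem mem_orth_graph_iff {T : B →ₗ.[ℂ] B} {t y : B} :
    (t, -y) ∈ orth T.graph ↔ (y, t) ∈ adjointGraph T := by
  constructor
  · intro h x
    have := h _ (T.mem_graph x)
    simp only [mul_neg, ← sub_eq_add_neg] at this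
    exact (sub_eq_zero.1 this).symm
  · rintro h ⟨u, v⟩ hp
    obtain ⟨x, rfl, rfl⟩ := T.mem_graph_iff.1 hp
    simp only [mul_neg, ← sub_eq_add_neg]
    exact sub_eq_zero.2 (h x).symm

/-- The graph of `T**` is the second orthogonal complement of the graph of `T`. -/
theorem adjointGraph_adjoint {T : B →ₗ.[ℂ] B} (hT : Dense (T.domain : Set B)) :
    adjointGraph (adjoint T) = orth (orth T.graph) := by
  ext ⟨x, w⟩
  constructor
  · rintro h ⟨t, y⟩ hq
    have hy : (-y, t) ∈ (adjoint T).graph := by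
      rw [adjoint_graph hT, ← mem_orth_graph_iff, neg_neg]
      exact hq
    obtain ⟨y', hy', rfl⟩ := (adjoint T).mem_graph_iff.1 hy
    have hy'' : y = -(y' : B) := by rw [hy']; simp
    have := h y'
    simp only [hy'', star_neg, neg_mul, this] at this ⊢
    simp
  · intro h y
    have hy : (adjoint T y, -(y : B)) ∈ orth T.graph := by
      rw [mem_orth_graph_iff, ← adjoint_graph hT]
      exact (adjoint T).mem_graph y
    have := h _ hy
    simp only [star_neg, neg_mul, ← sub_eq_add_neg] at this
    exact sub_eq_zero.1 this

/-- An element is zero if `star u * y = 0` for all `y` in a dense set. -/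
theorem eq_zero_of_dense {s : Set B} (hs : Dense s) {u : B} (h : ∀ y ∈ s, star u * y = 0) :
    u = 0 := by
  have hcl : IsClosed {y : B | star u * y = 0} := isClosed_eq (by fun_prop) continuous_const
  exact CStarRing.star_mul_self_eq_zero_iff u |>.1 (closure_minimal h hcl (hs u))

/-- A semiregular operator is right linear. -/
theorem IsSemiregular.mul_mem_graph {T : B →ₗ.[ℂ] B} (hT : IsSemiregular T) {x w : B}
    (h : (x, w) ∈ T.graph) (b : B) : (x * b, w * b) ∈ T.graph := by
  obtain ⟨x, rfl, rfl⟩ := T.mem_graph_iff.1 h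
  let xb : T.domain := ⟨x * b, hT.domain_mul_mem _ x.2 b⟩
  have : T xb - T x * b = 0 := eq_zero_of_dense hT.dense_adjoint_domain fun y hy => by
    have hg : (y, adjoint T ⟨y, hy⟩) ∈ adjointGraph T := by
      rw [← adjoint_graph hT.dense_domain]
      exact (adjoint T).mem_graph ⟨y, hy⟩
    have h1 := hg xb
    have h2 := hg x
    simp only [xb] at h1 h2
    rw [star_sub, star_mul, sub_mul, mul_assoc, h2, h1, star_mul, mul_assoc, sub_self]
  exact T.mem_graph_iff.2 ⟨xb, rfl, sub_eq_zero.1 this⟩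

/-- The graph of a regular operator is orthogonally complemented. -/
theorem IsRegular.graph_sup_orth {T : B →ₗ.[ℂ] B} (hT : IsRegular T) :
    T.graph ⊔ orth T.graph = ⊤ := by
  have hcl : IsClosed ((T.graph ⊔ orth T.graph : Submodule ℂ (B × B)) : Set (B × B)) :=
    isClosed_sup_of_orthogonal hT.isClosed (isClosed_orth _) le_rfl
  have hadj : ∀ y : (adjoint T).domain, (adjoint T y, -(y : B)) ∈ orth T.graph := fun y => by
    rw [mem_orth_graph_iff, ← adjoint_graph hT.isSemiregular.dense_domain]
    exact (adjoint T).mem_graph y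
  have h1 : ∀ a : B, (a, (0 : B)) ∈ T.graph ⊔ orth T.graph := fun a => by
    refine closure_minimal (t := (fun a : B => (a, (0 : B))) ⁻¹' _) ?_
      (hcl.preimage (by fun_prop)) (hT.dense_range a)
    rintro _ ⟨x, hx, rfl⟩
    have := Submodule.add_mem_sup (T.mem_graph x) (hadj ⟨T x, hx⟩)
    simpa using this
  have h2 : ∀ a : B, ((0 : B), a) ∈ T.graph ⊔ orth T.graph := fun a => by
    refine closure_minimal (t := (fun a : B => ((0 : B), a)) ⁻¹' _) ?_
      (hcl.preimage (by fun_prop)) (hT.isSemiregular.dense_adjoint_domain a)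
    intro y hy
    have := sub_mem (h1 (adjoint T ⟨y, hy⟩)) (Submodule.mem_sup_right (hadj ⟨y, hy⟩))
    simpa using this
  refine (Submodule.eq_top_iff').2 fun p => ?_
  simpa using add_mem (h1 p.1) (h2 p.2)

/-- If `S` is semiregular and the sum of `graph S**` and its orthogonal complement contains
`B × 0`, then `S**` is regular. -/
theorem IsSemiregular.isRegular_adjoint_adjoint {S : B →ₗ.[ℂ] B} (hS : IsSemiregular S)
    (h : ∀ a : B, (a, (0 : B)) ∈ orth (orth S.graph) ⊔ orth S.graph) :
    IsRegular (adjoint (adjoint S)) := by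
  have hgraph : (adjoint (adjoint S)).graph = orth (orth S.graph) := by
    rw [adjoint_graph hS.dense_adjoint_domain, adjointGraph_adjoint hS.dense_domain]
  have hclosed : (adjoint (adjoint S)).IsClosed := by
    rw [LinearPMap.IsClosed, hgraph]
    exact isClosed_orth _
  have hdense : Dense ((adjoint (adjoint S)).domain : Set B) := by
    refine hS.dense_domain.mono fun x hx => ?_
    refine LinearPMap.mem_domain_of_mem_graph (y := S ⟨x, hx⟩) ?_
    rw [hgraph]
    exact le_orth_orth _ (S.mem_graph ⟨x, hx⟩)
  have hadj : ∀ {y t : B}, (t, -y) ∈ orth S.graph →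
      (y, t) ∈ (adjoint (adjoint (adjoint S))).graph := fun {y t} hy => by
    rw [adjoint_graph hdense, ← mem_orth_graph_iff, hgraph]
    exact le_orth_orth _ hy
  refine ⟨⟨fun a ha b => ?_, hdense, hclosed.isClosable, ?_⟩, hclosed, fun a => subset_closure ?_⟩
  · have hg := (adjoint (adjoint S)).mem_graph ⟨a, ha⟩
    rw [hgraph] at hg
    refine LinearPMap.mem_domain_of_mem_graph (y := adjoint (adjoint S) ⟨a, ha⟩ * b) ?_
    rw [hgraph]
    exact orth_mul_mem hg b
  · refine hS.dense_adjoint_domain.mono fun y hy => ?_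
    refine LinearPMap.mem_domain_of_mem_graph (y := adjoint S ⟨y, hy⟩) (hadj ?_)
    rw [mem_orth_graph_iff, ← adjoint_graph hS.dense_domain]
    exact (adjoint S).mem_graph ⟨y, hy⟩
  · obtain ⟨⟨x, w⟩, hp, ⟨t, y⟩, hq, hpq⟩ := Submodule.mem_sup.1 (h a)
    obtain ⟨hxt, hwy⟩ := Prod.ext_iff.1 hpq
    simp only [Prod.fst_add, Prod.snd_add] at hxt hwy
    obtain rfl : y = -w := eq_neg_of_add_eq_zero_right hwy
    rw [← hgraph] at hp
    obtain ⟨x, rfl, rfl⟩ := LinearPMap.mem_graph_iff _ |>.1 hp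
    have hg := hadj hq
    obtain ⟨u, hu, hut⟩ := LinearPMap.mem_graph_iff _ |>.1 hg
    simp only at hu hut
    refine ⟨x, hu ▸ u.2, ?_⟩
    rw [← hxt, ← hut]
    congr 2
    exact Subtype.ext hu

/-! ### Closed right ideals -/

/-- The self-adjoint part `E ∩ E*` of a closed right ideal `E`. -/
def rightIdealSymmPart (E : Submodule ℂ B) (hmul : ∀ a ∈ E, ∀ b : B, a * b ∈ E) :
    NonUnitalStarSubalgebra ℂ B where
  carrier := {a | a ∈ E ∧ star a ∈ E}
  zero_mem' := ⟨E.zero_mem, by rw [star_zero]; exact E.zero_mem⟩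
  add_mem' := fun ha hb => ⟨E.add_mem ha.1 hb.1, by rw [star_add]; exact E.add_mem ha.2 hb.2⟩
  mul_mem' := fun ha hb => ⟨hmul _ ha.1 _, by rw [star_mul]; exact hmul _ hb.2 _⟩
  smul_mem' := fun c _ ha => ⟨E.smul_mem c ha.1, by rw [star_smul]; exact E.smul_mem _ ha.2⟩
  star_mem' := fun ha => ⟨ha.2, by rw [star_star]; exact ha.1⟩

/-- A closed right ideal that contains `c* c + s* s` contains `c*`: if `e` runs through an
approximate unit of the C*-algebra `E ∩ E*`, then `‖c - c e‖² ≤ ‖(1 - e) (c* c + s* s) (1 - e)‖`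
tends to zero. -/
theorem star_mem_of_star_mul_add_star_mul_mem (E : Submodule ℂ B) (hE : IsClosed (E : Set B))
    (hmul : ∀ a ∈ E, ∀ b : B, a * b ∈ E) {c s : B} (h : star c * c + star s * s ∈ E) :
    star c ∈ E := by
  let M := rightIdealSymmPart E hmul
  have : IsClosed (M : Set B) := IsClosed.inter hE (hE.preimage continuous_star)
  let : PartialOrder M := CStarAlgebra.spectralOrder M
  have : StarOrderedRing M := CStarAlgebra.spectralOrderedRing M
  let b : M := ⟨star c * c + star s * s, h, by
    simpa only [star_add, star_mul, star_star] using h⟩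
  have hunit := CStarAlgebra.increasingApproximateUnit M
  have hb : Filter.Tendsto (fun e : M => ‖b - b * e‖) (CStarAlgebra.approximateUnit M)
      (nhds 0) := by
    have := (tendsto_const_nhds (x := b)).sub (hunit.tendsto_mul_left b)
    simpa using this.norm
  have hev : ∀ᶠ e : M in CStarAlgebra.approximateUnit M,
      ‖c - c * (e : B)‖ ^ 2 ≤ 2 * ‖b - b * e‖ := by
    filter_upwards [hunit.eventually_star_eq, hunit.eventually_norm] with e he hn
    let : PartialOrder B := CStarAlgebra.spectralOrder B
    have : StarOrderedRing B := CStarAlgebra.spectralOrderedRing B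
    have he' : star (e : B) = e := congrArg Subtype.val he
    have hn' : ‖(e : B)‖ ≤ 1 := hn
    have key : star (c - c * (e : B)) * (c - c * (e : B)) +
        star (s - s * (e : B)) * (s - s * (e : B)) =
        ((b - b * e : M) : B) - (e : B) * ((b - b * e : M) : B) := by
      simp only [star_sub, star_mul, he', NonUnitalStarSubalgebra.coe_sub,
        NonUnitalStarSubalgebra.coe_mul, b]
      noncomm_ring
    have h1 : ‖c - c * (e : B)‖ ^ 2 ≤
        ‖((b - b * e : M) : B) - (e : B) * ((b - b * e : M) : B)‖ := by
      rw [← key, pow_two, ← CStarRing.norm_star_mul_self]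
      exact CStarAlgebra.norm_le_norm_of_nonneg_of_le (star_mul_self_nonneg _)
        (le_add_of_nonneg_right (star_mul_self_nonneg _))
    have h2 : ‖(e : B) * ((b - b * e : M) : B)‖ ≤ ‖b - b * e‖ :=
      (norm_mul_le _ _).trans (mul_le_of_le_one_left (norm_nonneg _) hn')
    have h3 : ‖((b - b * e : M) : B)‖ = ‖b - b * e‖ := rfl
    have h4 := norm_sub_le ((b - b * e : M) : B) ((e : B) * ((b - b * e : M) : B))
    linarith
  have hsq : Filter.Tendsto (fun e : M => ‖c - c * (e : B)‖ ^ 2)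
      (CStarAlgebra.approximateUnit M) (nhds 0) :=
    tendsto_of_tendsto_of_tendsto_of_le_of_le' tendsto_const_nhds
      (by simpa using hb.const_mul 2) (Filter.Eventually.of_forall fun e => by positivity) hev
  have hlim : Filter.Tendsto (fun e : M => star (c * (e : B)))
      (CStarAlgebra.approximateUnit M) (nhds (star c)) := by
    refine (continuous_star.tendsto c).comp (tendsto_iff_norm_sub_tendsto_zero.2 ?_)
    have := (Real.continuous_sqrt.tendsto 0).comp hsq
    simp only [Real.sqrt_zero] at this
    refine this.congr fun e => ?_
    simp only [Function.comp_apply]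
    rw [Real.sqrt_sq (norm_nonneg _), norm_sub_rev]
  refine hE.mem_of_tendsto hlim (Filter.Eventually.of_forall fun e => ?_)
  rw [star_mul]
  exact hmul _ e.2.2 _

/-! ### Semiregular operators that are regular on an ideal -/

section Extension

variable {A : Type*} [NonUnitalCStarAlgebra A] {K : ClosedIdeal A} {S : A →ₗ.[ℂ] A}

/-- The graph of `(S|_K)*` is contained in the graph of `S*`, in terms of complements. -/
theorem IsSemiregular.coe_mem_orth_graph (hS : IsSemiregular S) {q : K.Alg × K.Alg}
    (hq : q ∈ orth (restrict S K).graph) : ((q.1 : A), (q.2 : A)) ∈ orth S.graph := by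
  rintro ⟨x, w⟩ hp
  set u : A := star x * q.1 + star w * q.2 with hu
  have huK : u ∈ K.toSubmodule :=
    K.toSubmodule.add_mem (K.mul_mem_left _ q.1.2) (K.mul_mem_left _ q.2.2)
  -- `u = 0` because `k* u = ⟨(x, w) k, q⟩ = 0` for all `k ∈ K`, in particular for `k = u`.
  have hk : ∀ k : K.Alg, star (k : A) * u = 0 := fun k => by
    have hxk : ((⟨x * k, K.mul_mem_left _ k.2⟩, ⟨w * k, K.mul_mem_left _ k.2⟩) : K.Alg × K.Alg) ∈
        (restrict S K).graph :=
      (mem_restrict_graph_iff S K _).2 (hS.mul_mem_graph hp k)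
    have h0 := congrArg Subtype.val (hq _ hxk)
    have h1 : star (x * (k : A)) * q.1 + star (w * (k : A)) * q.2 = 0 := h0
    rw [hu, mul_add, ← mul_assoc, ← mul_assoc, ← star_mul, ← star_mul, h1]
  exact CStarRing.star_mul_self_eq_zero_iff u |>.1 (hk ⟨u, huK⟩)

theorem IsSemiregular.ideal_prod_mem (hS : IsSemiregular S) (hSK : IsRegular (restrict S K))
    {k l : A} (hk : k ∈ K.toSubmodule) (hl : l ∈ K.toSubmodule) :
    (k, l) ∈ orth (orth S.graph) ⊔ orth S.graph := by
  have hmem : ((⟨k, hk⟩, ⟨l, hl⟩) : K.Alg × K.Alg) ∈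
      (restrict S K).graph ⊔ orth (restrict S K).graph := by
    rw [hSK.graph_sup_orth]
    trivial
  obtain ⟨p, hp, q, hq, hpq⟩ := Submodule.mem_sup.1 hmem
  have h1 : (p.1 : A) + q.1 = k := congrArg (fun r : K.Alg × K.Alg => (r.1 : A)) hpq
  have h2 : (p.2 : A) + q.2 = l := congrArg (fun r : K.Alg × K.Alg => (r.2 : A)) hpq
  have := Submodule.add_mem_sup (le_orth_orth _ ((mem_restrict_graph_iff S K p).1 hp))
    (hS.coe_mem_orth_graph hq)
  simpa [h1, h2] using this

/-- If `c ∈ D(S)` is central modulo `K` and `s = S c`, then `c* c + s* s` is in the range of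
`I + S* S**`. -/
theorem IsSemiregular.star_mul_self_add_mem (hS : IsSemiregular S)
    (hSK : IsRegular (restrict S K)) {c s : A} (hc : (c, s) ∈ S.graph)
    (hcomm : ∀ a : A, c * a - a * c ∈ K.toSubmodule) :
    (star c * c + star s * s, (0 : A)) ∈ orth (orth S.graph) ⊔ orth S.graph := by
  set F := orth (orth S.graph) ⊔ orth S.graph
  have hF : IsClosed (F : Set (A × A)) := by
    rw [show F = orth S.graph ⊔ orth (orth S.graph) from sup_comm _ _]
    exact isClosed_sup_of_orthogonal (isClosed_orth _) (isClosed_orth _) le_rfl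
  have hcomm' : ∀ a : A, star c * a - a * star c ∈ K.toSubmodule := fun a => by
    have := K.toSubmodule.neg_mem (K.star_mem (hcomm (star a)))
    simpa using this
  have hadj : ∀ y ∈ (adjoint S).domain, (star s * y, -(y * star c)) ∈ F := fun y hy => by
    have hg : (y, adjoint S ⟨y, hy⟩) ∈ adjointGraph S := by
      rw [← adjoint_graph hS.dense_domain]
      exact (adjoint S).mem_graph ⟨y, hy⟩
    set t := adjoint S ⟨y, hy⟩
    have hst : star s * y = star c * t := by
      obtain ⟨x, rfl, rfl⟩ := S.mem_graph_iff.1 hc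
      exact hg x
    have h1 := orth_mul_mem (mem_orth_graph_iff.2 hg) (star c)
    have h2 := add_mem (Submodule.mem_sup_right h1)
      (hS.ideal_prod_mem hSK (hcomm' t) K.toSubmodule.zero_mem)
    rw [hst]
    simpa using h2
  have hall : ∀ a : A, (star s * a, -(a * star c)) ∈ F := fun a =>
    closure_minimal (t := (fun a : A => (star s * a, -(a * star c))) ⁻¹' (F : Set (A × A)))
      hadj (hF.preimage (by fun_prop)) (hS.dense_adjoint_domain a)
  have h1 : (c * star c, s * star c) ∈ F :=
    Submodule.mem_sup_left (le_orth_orth _ (hS.mul_mem_graph hc (star c)))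
  have h2 := hS.ideal_prod_mem hSK (hcomm' c) K.toSubmodule.zero_mem
  have h3 := add_mem (add_mem h1 h2) (hall s)
  simpa using h3

end Extension

end CStarOp

open CStarOp in
theorem theorem3p1 {A : Type*} [NonUnitalCStarAlgebra A] [TopologicalSpace.SeparableSpace A]
    (K : ClosedIdeal A) (hK : K.IsEssential)
    (S : A →ₗ.[ℂ] A) (hS : CStarOp.IsSemiregular S) (hSclosed : S.IsClosed)
    (hSK : CStarOp.IsRegular (CStarOp.restrict S K))
    (htotal : Dense (Submodule.span ℂ
      {w : K.Quotient | ∃ c ∈ Set.center K.Quotient ∩ K.proj '' (S.domain : Set A),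
        ∃ b : K.Quotient, w = c * b} : Set K.Quotient)) :
    CStarOp.IsRegular (CStarOp.adjoint (CStarOp.adjoint S)) := by
  refine hS.isRegular_adjoint_adjoint ?_
  set F := orth (orth S.graph) ⊔ orth S.graph
  have hF : IsClosed (F : Set (A × A)) := by
    rw [show F = orth S.graph ⊔ orth (orth S.graph) from sup_comm _ _]
    exact isClosed_sup_of_orthogonal (isClosed_orth _) (isClosed_orth _) le_rfl
  let E : Submodule ℂ A := F.comap (LinearMap.inl ℂ A A)
  have hE : IsClosed (E : Set A) := hF.preimage (f := fun a : A => (a, (0 : A))) (by fun_prop)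
  have hKE : K.toSubmodule ≤ E := fun k hk => hS.ideal_prod_mem hSK hk K.toSubmodule.zero_mem
  have hmul : ∀ a ∈ E, ∀ b : A, a * b ∈ E := fun a ha b => by
    obtain ⟨p, hp, q, hq, hpq⟩ := Submodule.mem_sup.1 (show (a, (0 : A)) ∈ F from ha)
    have h1 : p.1 + q.1 = a := congrArg Prod.fst hpq
    have h2 : p.2 + q.2 = 0 := congrArg Prod.snd hpq
    have := Submodule.add_mem_sup (orth_mul_mem hp b) (orth_mul_mem hq b)
    rw [Prod.mk_add_mk, ← add_mul, ← add_mul, h1, h2, zero_mul] at this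
    exact this
  have hcE : ∀ c ∈ S.domain, K.proj c ∈ Set.center K.Quotient → c ∈ E := fun c hc hcen => by
    have hcomm : ∀ a : A, c * a - a * c ∈ K.toSubmodule := fun a => by
      refine (Submodule.Quotient.eq K.toSubmodule).1 ?_
      exact (Set.mem_center_iff.1 hcen).comm (K.proj a)
    have h1 : star c ∈ E := star_mem_of_star_mul_add_star_mul_mem E hE hmul
      (hS.star_mul_self_add_mem hSK (S.mem_graph ⟨c, hc⟩) hcomm)
    have h2 : c * star c ∈ E := by
      have := add_mem (hmul _ h1 c) (hKE (hcomm (star c)))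
      simpa using this
    have h3 : star (star c) ∈ E :=
      star_mem_of_star_mul_add_star_mul_mem E hE hmul (s := 0) (by simpa using h2)
    rwa [star_star] at h3
  have hspan : Submodule.span ℂ
      {w : K.Quotient | ∃ c ∈ Set.center K.Quotient ∩ K.proj '' (S.domain : Set A),
        ∃ b : K.Quotient, w = c * b} ≤ E.map K.proj := by
    refine Submodule.span_le.2 ?_
    rintro _ ⟨_, ⟨hcen, c, hc, rfl⟩, b, rfl⟩
    obtain ⟨b, rfl⟩ := K.proj_surjective b
    exact ⟨c * b, hmul c (hcE c hc hcen) b, K.proj_mul c b⟩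
  -- `E` is saturated for the open map `π`, so density of `π E` gives density of `E`.
  have hpre : K.proj ⁻¹' (E.map K.proj : Set K.Quotient) = (E : Set A) := by
    ext a
    constructor
    · rintro ⟨e, he, hea⟩
      have hk : a - e ∈ K.toSubmodule := (Submodule.Quotient.eq K.toSubmodule).1 hea.symm
      simpa using add_mem (hKE hk) he
    · exact fun ha => ⟨a, ha, rfl⟩
  have hdense : Dense (E : Set A) := by
    rw [← hpre]
    exact (htotal.mono hspan).preimage K.toSubmodule.isOpenMap_mkQ
  intro a
  have ha : a ∈ closure (E : Set A) := hdense a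
  rw [hE.closure_eq] at ha
  exact ha
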